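/- Let $n\ge 1$ agents $\mathcal V=\{1,\dots,n\}$ have private convex costs $f_i:\mathbb R^d\to\mathbb R$, let $f=\frac1n\sum_{i=1}^n f_i$, and let $z^*$ be a minimizer of $f$. Let $\mathbb G(t)=(\mathcal V,\mathcal E(t))$, $t\ge 0$, be directed graphs with self-arcs at all vertices such that, for some integer $L\ge1$ and every $t\ge0$, the union of $\mathbb G(t),\dots,\mathbb G(t+L-1)$ is strongly connected. Let $w_{ij}(t)$ be weights such that, for some constant $\beta>0$, $w_{ij}(t)\ge\beta$ if $(j,i)\in\mathcal E(t)$ and $w_{ij}(t)=0$ otherwise, and $\sum_{i=1}^n w_{ij}(t)=1$ for all $j$ and $t$. Given arbitrary switching signals $\sigma_i(t)\in\{0,1\}$ and arbitrary $x_i(0)\in\mathbb R^d$, the heterogeneous subgradient algorithm is $$x_i(t+1)=\sum_{j=1}^n w_{ij}(t)\big[x_j(t)-\alpha(t)g_j(t)\sigma_j(t)\big]-\alpha(t)g_i(t)(1-\sigma_i(t)),$$ $$y_i(t+1)=\sum_{j=1}^n w_{ij}(t)y_j(t),\qquad y_i(0)=1,$$ where $z_i(t)=x_i(t)/y_i(t)$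 and $g_i(t)$ is any subgradient of $f_i$ at $z_i(t)$. Put $\bar z(t)=\frac1n\sum_{i=1}^n z_i(t)$. Let $G>0$ be such that, for all $i\in\mathcal V$ and $t\ge0$, all subgradients of $f_i$ at the points $z_1(t),\dots,z_n(t)$ and $\bar z(t)$ have Euclidean norm at most $G$ (in particular $\|g_i(t)\|\le G$). Put $b=\min\{\beta,\frac1n\}$, $$\eta=b^{nL},\qquad \mu=\big(1-b^{nL}\big)^{1/L};$$ if $\beta\ge\frac1n$, in particular for $w_{ij}(t)=1/|\{k:(j,k)\in\mathcal E(t)\}|$ for $(j,i)\in\mathcal E(t)$ with $\beta=\frac1n$, these are $\eta=\frac1{n^{nL}}$ and $\mu=(1-\frac1{n^{nL}})^{1/L}$. 1) If $\alpha(t)$ is positive and non-increasing with $\sum_t\alpha(t)=\infty$ and $\sum_t\alpha^2(t)<\infty$, then for all $t\ge0$ $$f\Big(\tfrac{\sum_{\tau=0}^t\alpha(\tau)\bar z(\tau)}{\sum_{\tau=0}^t\alpha(\tau)}\Big)-f(z^*)\le \frac{\|\bar z(0)-z^*\|^2+G^2\sum_{\tau=0}^t\alpha^2(\tau)}{2\sum_{\tau=0}^t\alpha(\tau)}+\frac{2G\alpha(0)\sum_{i=1}^n\|\bar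 z(0)-z_i(0)\|}{n\sum_{\tau=0}^t\alpha(\tau)}+A_t,$$ and for every $k\in\mathcal V$ $$f\Big(\tfrac{\sum_{\tau=0}^t\alpha(\tau) z_k(\tau)}{\sum_{\tau=0}^t\alpha(\tau)}\Big)-f(z^*)\le \frac{\|\bar z(0)-z^*\|^2+G^2\sum_{\tau=0}^t\alpha^2(\tau)}{2\sum_{\tau=0}^t\alpha(\tau)}+\frac{G\alpha(0)\sum_{i=1}^n(\|\bar z(0)-z_i(0)\|+\|z_k(0)-z_i(0)\|)}{n\sum_{\tau=0}^t\alpha(\tau)}+A_t,$$ where $$A_t=\frac{32G\sum_{i=1}^n\|x_i(0)\|}{\eta}\,\frac{\sum_{\tau=0}^{t-1}\alpha(\tau)\mu^\tau}{\sum_{\tau=0}^t\alpha(\tau)}+\frac{32nG^2}{\eta\mu(1-\mu)}\,\frac{\sum_{\tau=0}^{t-1}\alpha(\tau)\big(\alpha(0)\mu^{\tau/2}+\alpha(\lceil\tau/2\rceil)\big)}{\sum_{\tau=0}^t\alpha(\tau)}.$$ 2) If $\alpha(t)=1/\sqrt T$ for $t\in\{0,\dots,T-1\}$, where $T\ge1$,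 then $$f\Big(\tfrac1T\sum_{\tau=0}^{T-1}\bar z(\tau)\Big)-f(z^*)\le\frac{\|\bar z(0)-z^*\|^2+G^2}{2\sqrt T}+\frac{2G\sum_{i=1}^n\|\bar z(0)-z_i(0)\|}{nT}+B_T,$$ and for every $k\in\mathcal V$ $$f\Big(\tfrac1T\sum_{\tau=0}^{T-1}z_k(\tau)\Big)-f(z^*)\le\frac{\|\bar z(0)-z^*\|^2+G^2}{2\sqrt T}+\frac{G\sum_{i=1}^n(\|\bar z(0)-z_i(0)\|+\|z_k(0)-z_i(0)\|)}{nT}+B_T,$$ where $$B_T=\frac{32G\sum_{i=1}^n\|x_i(0)\|}{\eta(1-\mu)T}+\frac{32nG^2}{\eta\mu(1-\mu)\sqrt T}.$$ (If $\mu=0$, which happens only for $n=\beta=1$, the terms with the factor $\frac{1}{\eta\mu(1-\mu)}$ are read as $0$.) -/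

import Mathlib

open Filter Finset

noncomputable section

namespace HeteroPush

/-- `v` is a subgradient of `h : ℝᵈ → ℝ` at the point `x`. -/
def IsSubgradientAt {d : ℕ} (h : EuclideanSpace ℝ (Fin d) → ℝ)
    (x v : EuclideanSpace ℝ (Fin d)) : Prop :=
  ∀ y, h x + inner ℝ v (y - x) ≤ h y

/-- The network cost `f(z) = (1/n) ∑ᵢ fᵢ(z)`. -/
def averageCost {n d : ℕ} (f : Fin n → EuclideanSpace ℝ (Fin d) → ℝ)
    (z : EuclideanSpace ℝ (Fin d)) : ℝ :=
  (1 / (n : ℝ)) * ∑ i, f i z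

/-- The set of minimizers of a real-valued function. -/
def optimalSet {d : ℕ} (h : EuclideanSpace ℝ (Fin d) → ℝ) :
    Set (EuclideanSpace ℝ (Fin d)) :=
  {z | ∀ w, h z ≤ h w}

/-- A directed graph is strongly connected: there is a directed path from any vertex to any
other vertex. -/
def StronglyConnected {V : Type*} (H : Digraph V) : Prop :=
  ∀ i j, Relation.ReflTransGen H.Adj i j

/-- `{𝔾(t)}` is uniformly strongly connected by sub-sequences of length `L`: `L` is a positive
integer and for every `t` the union of `𝔾(t), …, 𝔾(t+L-1)` is strongly connected. -/
def UniformlyStronglyConnected {V : Type*} (𝔾 : ℕ → Digraph V) (L : ℕ) : Prop :=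
  0 < L ∧ ∀ t, StronglyConnected (⨆ s : Fin L, 𝔾 (t + s))

/-- Admissible weights with lower bound `β`. The arc `(j, i)`, that is `(𝔾 t).Adj j i`, means
that `j` is an in-neighbor of `i` at time `t`. The matrix `W t` has the entries `w_{ij}(t)`, which
are set to zero when `j` is not an in-neighbor of `i`, are at least `β > 0` otherwise, and the
weights that an agent `i` assigns to its out-neighbors sum up to one. -/
structure WeightAssumption {n : ℕ} (𝔾 : ℕ → Digraph (Fin n))
    (W : ℕ → Matrix (Fin n) (Fin n) ℝ) (β : ℝ) : Prop where
  pos : 0 < β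
  le_weight : ∀ t i j, (𝔾 t).Adj j i → β ≤ W t i j
  eq_zero : ∀ t i j, ¬ (𝔾 t).Adj j i → W t i j = 0
  sum_eq_one : ∀ t i, ∑ j, W t j i = 1

/-- Time-varying step sizes: positive, non-increasing, not summable, square summable. -/
structure StepSizeAssumption (α : ℕ → ℝ) : Prop where
  pos : ∀ t, 0 < α t
  antitone : Antitone α
  sum_eq_top : Tendsto (fun t => ∑ τ ∈ range t, α τ) atTop atTop
  sum_sq : Summable (fun t => α t ^ 2)

/-- The push-sum variables: `y_i(0) = 1`, `y_i(t+1) = ∑ⱼ w_{ij}(t) y_j(t)`. -/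
def yState {n : ℕ} (W : ℕ → Matrix (Fin n) (Fin n) ℝ) : ℕ → Fin n → ℝ
  | 0 => fun _ => 1
  | t + 1 => fun i => ∑ j, W t i j * yState W t j

/-- The `x`-variables of the heterogeneous algorithm that uses the directions `g_i(t)`, the
switching signals `σ_i(t)` (`1`: subgradient step first, `0`: push-sum step first), and starts
at `x_i(0)`:
`x_i(t+1) = ∑ⱼ w_{ij}(t) [x_j(t) - α(t) g_j(t) σ_j(t)] - α(t) g_i(t) (1 - σ_i(t))`. -/
def xState {n d : ℕ} (W : ℕ → Matrix (Fin n) (Fin n) ℝ) (α : ℕ → ℝ) (σ : ℕ → Fin n → ℝ)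
    (g : ℕ → Fin n → EuclideanSpace ℝ (Fin d)) (x₀ : Fin n → EuclideanSpace ℝ (Fin d)) :
    ℕ → Fin n → EuclideanSpace ℝ (Fin d)
  | 0 => x₀
  | t + 1 => fun i =>
      (∑ j, W t i j • (xState W α σ g x₀ t j - (α t * σ t j) • g t j))
        - (α t * (1 - σ t i)) • g t i

/-- `z_i(t) = x_i(t) / y_i(t)`. -/
def zState {n d : ℕ} (W : ℕ → Matrix (Fin n) (Fin n) ℝ) (α : ℕ → ℝ) (σ : ℕ → Fin n → ℝ)
    (g : ℕ → Fin n → EuclideanSpace ℝ (Fin d)) (x₀ : Fin n → EuclideanSpace ℝ (Fin d))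
    (t : ℕ) (i : Fin n) : EuclideanSpace ℝ (Fin d) :=
  (yState W t i)⁻¹ • xState W α σ g x₀ t i

/-- The average `(1/n) ∑ᵢ vᵢ` of `n` vectors. -/
def average {n d : ℕ} (v : Fin n → EuclideanSpace ℝ (Fin d)) : EuclideanSpace ℝ (Fin d) :=
  (1 / (n : ℝ)) • ∑ i, v i

/-- A run of the heterogeneous subgradient algorithm: the switching signals take values in
`{0, 1}` and `g_i(t)` is a subgradient of `f_i` at `z_i(t)`. Neither the signals nor the choice
of the subgradients are restricted otherwise. -/
structure IsRun {n d : ℕ} (f : Fin n → EuclideanSpace ℝ (Fin d) → ℝ)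
    (W : ℕ → Matrix (Fin n) (Fin n) ℝ) (α : ℕ → ℝ) (σ : ℕ → Fin n → ℝ)
    (g : ℕ → Fin n → EuclideanSpace ℝ (Fin d)) (x₀ : Fin n → EuclideanSpace ℝ (Fin d)) :
    Prop where
  switching : ∀ t i, σ t i = 0 ∨ σ t i = 1
  subgradient : ∀ t i, IsSubgradientAt (f i) (zState W α σ g x₀ t i) (g t i)

/-- At every time `t`, all subgradients of every `f_i` at each of the points
`z_1(t), …, z_n(t)` and `z̄(t)` have norm at most `G`. -/
def SubgradientsBoundedBy {n d : ℕ} (f : Fin n → EuclideanSpace ℝ (Fin d) → ℝ)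
    (z : ℕ → Fin n → EuclideanSpace ℝ (Fin d)) (G : ℝ) : Prop :=
  ∀ t i p, (p = average (z t) ∨ ∃ k, p = z t k) →
    ∀ v, IsSubgradientAt (f i) p v → ‖v‖ ≤ G

end HeteroPush

end

noncomputable section

namespace HeteroPush

/-! Because the columns of `W t` sum to one, summing the update over the agents removes both the
weights and the switching signals: the average x̄ of the `x_i` moves by exactly `-α(t)` times the
average of the `g_i(t)`. The algorithm is therefore a centralized subgradient method for x̄ whose
subgradients are taken at the displaced points `z_i`. Expanding the squared distance to `z*`,
telescoping and applying Jensen's inequality (`descent_step`, `averageCost_weighted_sub_le`) leaves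
an error proportional to the weighted sum of `‖z_i - x̄‖ + ‖p - z_i‖`, where `p` is the point being
averaged (z̄ or `z_k`).

It remains to bound the disagreement `‖z_i - x̄‖`. Uniform strong connectivity makes every entry of
a product of `n * L` weight matrices at least `η` (`pow_le_transition`). Such a block contracts the
spread of each row of the transition matrix by `1 - nη`, and Bernoulli's inequality gives `1 - nη ≤
(1 - η)^n = μ^(nL)`. Since `y_i / n` lies in the range of its row and `y_i ≥ η`, division by `y_i`
is harmless, and `norm_zState_sub_average_le` bounds the disagreement by a geometric term from the
initial values plus a convolution of the step sizes with powers of `μ`. For decreasing steps the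
convolution is split at its midpoint (`sum_antitone_mul_pow_le`); for constant steps it is a
geometric series. -/

/-- The transition matrix `W (t-1) * ⋯ * W s` of the linear iteration from time `s` to `t`. -/
def transition {n : ℕ} (W : ℕ → Matrix (Fin n) (Fin n) ℝ) : ℕ → ℕ → Matrix (Fin n) (Fin n) ℝ
  | 0, _ => 1
  | t + 1, s => if s ≤ t then W t * transition W t s else 1

/-! ### Products of column-stochastic matrices and the push-sum weights. -/

section Transition

variable {n : ℕ} {W : ℕ → Matrix (Fin n) (Fin n) ℝ}

lemma transition_self (t : ℕ) : transition W t t = 1 := by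
  cases t <;> simp [transition]

lemma transition_succ {s t : ℕ} (h : s ≤ t) :
    transition W (t + 1) s = W t * transition W t s := by
  simp [transition, h]

lemma transition_mul {s r t : ℕ} (hsr : s ≤ r) (hrt : r ≤ t) :
    transition W t s = transition W t r * transition W r s := by
  induction t, hrt using Nat.le_induction with
  | base => simp [transition_self]
  | succ t h ih => rw [transition_succ (hsr.trans h), transition_succ h, ih, Matrix.mul_assoc]

lemma transition_nonneg (hnn : ∀ t i j, 0 ≤ W t i j) {s t : ℕ} (h : s ≤ t) (i j : Fin n) :
    0 ≤ transition W t s i j := by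
  induction t, h using Nat.le_induction generalizing i with
  | base => rw [transition_self, Matrix.one_apply]; split_ifs <;> norm_num
  | succ t h ih =>
    rw [transition_succ h, Matrix.mul_apply]
    exact sum_nonneg fun k _ => mul_nonneg (hnn _ _ _) (ih _)

lemma transition_col_sum (hcol : ∀ t j, ∑ i, W t i j = 1) {s t : ℕ} (h : s ≤ t) (j : Fin n) :
    ∑ i, transition W t s i j = 1 := by
  induction t, h using Nat.le_induction with
  | base => simp [transition_self, Matrix.one_apply]
  | succ t h ih =>
    simp_rw [transition_succ h, Matrix.mul_apply]
    rw [sum_comm]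
    simp_rw [← sum_mul, hcol, one_mul, ih]

lemma transition_le_one (hnn : ∀ t i j, 0 ≤ W t i j) (hcol : ∀ t j, ∑ i, W t i j = 1)
    {s t : ℕ} (h : s ≤ t) (i j : Fin n) : transition W t s i j ≤ 1 := by
  rw [← transition_col_sum hcol h j]
  exact single_le_sum (f := fun i => transition W t s i j)
    (fun k _ => transition_nonneg hnn h k j) (mem_univ i)

lemma mul_pow_le_transition_succ (hnn : ∀ t i j, 0 ≤ W t i j) {b : ℝ} (hb : 0 ≤ b) {s t : ℕ}
    (h : s ≤ t) {i k j : Fin n} (hik : b ≤ W t i k)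
    (hk : b ^ (t - s) ≤ transition W t s k j) :
    b ^ (t + 1 - s) ≤ transition W (t + 1) s i j := by
  rw [transition_succ h, Matrix.mul_apply, Nat.sub_add_comm h, pow_succ']
  refine (mul_le_mul hik hk (by positivity) (hnn _ _ _)).trans ?_
  exact single_le_sum (f := fun l => W t i l * transition W t s l j)
    (fun l _ => mul_nonneg (hnn _ _ _) (transition_nonneg hnn h l j)) (mem_univ k)

lemma pow_le_transition_diag (hnn : ∀ t i j, 0 ≤ W t i j) {b : ℝ} (hb : 0 ≤ b)
    (hdiag : ∀ t i, b ≤ W t i i) {s t : ℕ} (h : s ≤ t) (i : Fin n) :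
    b ^ (t - s) ≤ transition W t s i i := by
  induction t, h using Nat.le_induction with
  | base => simp [transition_self]
  | succ t h ih => exact mul_pow_le_transition_succ hnn hb h (hdiag t i) ih

/-- If a set of vertices is nondecreasing in time and closed under the arcs of a uniformly strongly
connected graph sequence with `n` vertices, then it contains all vertices after `n * L` steps. -/
lemma mem_of_uniformlyStronglyConnected {𝔾 : ℕ → Digraph (Fin n)} {L : ℕ}
    (hL : UniformlyStronglyConnected 𝔾 L) {A : ℕ → Finset (Fin n)} {s : ℕ} {j : Fin n}
    (hj : j ∈ A s) (hmono : ∀ t, s ≤ t → A t ⊆ A (t + 1))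
    (harc : ∀ t, s ≤ t → ∀ k i, (𝔾 t).Adj k i → k ∈ A t → i ∈ A (t + 1)) (i : Fin n) :
    i ∈ A (s + n * L) := by
  have hmono' : ∀ {t r}, s ≤ t → t ≤ r → A t ⊆ A r := by
    intro t r hst htr
    induction r, htr using Nat.le_induction with
    | base => exact Subset.rfl
    | succ r h ih => exact ih.trans (hmono r (hst.trans h))
  -- If nothing is gained during `L` steps, the set is closed under the arcs of the union graph over
  -- that window, so following paths from `j` reaches every vertex.
  have hgrow : ∀ t, s ≤ t → A (t + L) = A t → A t = univ := by
    intro t ht heq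
    have hjt : j ∈ A t := hmono' le_rfl ht hj
    refine eq_univ_iff_forall.2 fun i => ?_
    have hpath := hL.2 t j i
    induction hpath with
    | refl => exact hjt
    | tail _ hadj ih =>
      obtain ⟨r, hr⟩ := Digraph.iSup_adj.1 hadj
      rw [← heq]
      exact hmono' (by omega) (by have := r.2; omega)
        (harc (t + r) (by omega) _ _ hr (hmono' ht (by omega) ih))
  -- Every window of length `L` adds at least one vertex until all are present.
  have hcard : ∀ k, min n (k + 1) ≤ (A (s + k * L)).card := by
    intro k
    induction k with
    | zero =>
      have : 0 < (A s).card := card_pos.2 ⟨j, hj⟩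
      simp only [zero_mul, add_zero]; omega
    | succ k ih =>
      have hsub : A (s + k * L) ⊆ A (s + k * L + L) := hmono' (by omega) (by omega)
      rw [show s + (k + 1) * L = s + k * L + L by ring]
      by_cases heq : A (s + k * L + L) = A (s + k * L)
      · rw [heq, hgrow _ (by omega) heq]; simp
      · have := card_lt_card (hsub.ssubset_of_ne (Ne.symm heq))
        omega
  have huniv : A (s + n * L) = univ := by
    apply eq_univ_of_card
    have h1 := hcard n
    have h2 := card_le_univ (A (s + n * L))
    simp only [Fintype.card_fin] at *
    omega
  simp [huniv]

/-- One more step along an arc costs one more factor `b`. Hence the set of rows whose entry in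
column `j` is at least `b ^ (t - s)` spreads along arcs, and self-arcs keep it from shrinking. -/
lemma pow_le_transition {𝔾 : ℕ → Digraph (Fin n)} {L : ℕ}
    (hL : UniformlyStronglyConnected 𝔾 L) (hnn : ∀ t i j, 0 ≤ W t i j) {b : ℝ} (hb : 0 ≤ b)
    (hdiag : ∀ t i, b ≤ W t i i) (harc : ∀ t i j, (𝔾 t).Adj j i → b ≤ W t i j)
    (s : ℕ) (i j : Fin n) :
    b ^ (n * L) ≤ transition W (s + n * L) s i j := by
  classical
  have := mem_of_uniformlyStronglyConnected hL (s := s) (j := j)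
    (A := fun t => univ.filter fun i => b ^ (t - s) ≤ transition W t s i j)
    (by simp [transition_self])
    (fun t ht i hi => by
      simp only [mem_filter, mem_univ, true_and] at hi ⊢
      exact mul_pow_le_transition_succ hnn hb ht (hdiag t i) hi)
    (fun t ht k i hki hk => by
      simp only [mem_filter, mem_univ, true_and] at hk ⊢
      exact mul_pow_le_transition_succ hnn hb ht (harc t i k hki) hk) i
  simpa using this

/-- A column-stochastic matrix with entries at least `c` contracts the spread of a row vector. -/
lemma sum_mul_sub_sum_mul_le (hn : 0 < n) {M : Matrix (Fin n) (Fin n) ℝ} {c : ℝ}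
    (hM : ∀ i j, c ≤ M i j) (hcol : ∀ j, ∑ i, M i j = 1) {u : Fin n → ℝ} {S : ℝ}
    (hu : ∀ i j, u i - u j ≤ S) (j k : Fin n) :
    ∑ l, u l * M l j - ∑ l, u l * M l k ≤ (1 - n * c) * S := by
  have : Nonempty (Fin n) := ⟨⟨0, hn⟩⟩
  obtain ⟨p, hp⟩ := Finite.exists_max u
  obtain ⟨q, hq⟩ := Finite.exists_min u
  -- Subtracting `c` from all entries changes both sums by the same amount and leaves nonnegative
  -- columns of mass `1 - n * c`; only this mass can produce a difference.
  have hrem : ∀ j, ∑ l, (M l j - c) = 1 - n * c := by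
    intro j; simp [sum_sub_distrib, hcol]
  have hnc : 0 ≤ 1 - n * c := by
    rw [← hrem j]; exact sum_nonneg fun l _ => sub_nonneg.2 (hM l j)
  have h1 : ∑ l, u l * (M l j - c) ≤ u p * (1 - n * c) := by
    rw [← hrem j, mul_sum]
    exact sum_le_sum fun l _ => mul_le_mul_of_nonneg_right (hp l) (sub_nonneg.2 (hM l j))
  have h2 : u q * (1 - n * c) ≤ ∑ l, u l * (M l k - c) := by
    rw [← hrem k, mul_sum]
    exact sum_le_sum fun l _ => mul_le_mul_of_nonneg_right (hq l) (sub_nonneg.2 (hM l k))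
  have h3 := mul_le_mul_of_nonneg_left (hu p q) hnc
  simp only [mul_sub, sum_sub_distrib] at h1 h2
  linarith

lemma transition_sub_le_pow (hn : 0 < n) (hnn : ∀ t i j, 0 ≤ W t i j)
    (hcol : ∀ t j, ∑ i, W t i j = 1) {c : ℝ} {m : ℕ}
    (hpos : ∀ s i j, c ≤ transition W (s + m) s i j) (q : ℕ) {s t : ℕ} (h : s + q * m ≤ t)
    (i j k : Fin n) :
    transition W t s i j - transition W t s i k ≤ (1 - n * c) ^ q := by
  induction q generalizing s j k with
  | zero =>
    have hst : s ≤ t := by omega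
    have := transition_le_one hnn hcol hst i j
    have := transition_nonneg hnn hst i k
    simp only [pow_zero]; linarith
  | succ q ih =>
    have h' : s + m + q * m ≤ t := by linarith [add_mul q 1 m]
    -- The earliest block is split off: it multiplies row `i` of the later product from the right.
    -- This is why the induction varies the starting time `s`.
    rw [transition_mul (Nat.le_add_right s m) (le_trans (Nat.le_add_right _ _) h'),
      Matrix.mul_apply, Matrix.mul_apply, pow_succ']
    exact sum_mul_sub_sum_mul_le hn (hpos s)
      (transition_col_sum hcol (Nat.le_add_right s m)) (fun a b => ih h' a b) j k

lemma yState_eq_sum_transition (t : ℕ) (i : Fin n) :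
    yState W t i = ∑ k, transition W t 0 i k := by
  induction t generalizing i with
  | zero => simp [yState, transition_self, Matrix.one_apply]
  | succ t ih =>
    simp_rw [yState, ih, transition_succ (Nat.zero_le t), Matrix.mul_apply, mul_sum]
    exact sum_comm

lemma sum_yState (hcol : ∀ t j, ∑ i, W t i j = 1) (t : ℕ) : ∑ i, yState W t i = n := by
  simp_rw [yState_eq_sum_transition]
  refine sum_comm.trans ?_
  simp [transition_col_sum hcol (Nat.zero_le t)]

lemma yState_nonneg (hnn : ∀ t i j, 0 ≤ W t i j) (t : ℕ) (i : Fin n) : 0 ≤ yState W t i := by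
  rw [yState_eq_sum_transition]
  exact sum_nonneg fun k _ => transition_nonneg hnn (Nat.zero_le t) i k

lemma yState_eq_sum_mul {s t : ℕ} (h : s ≤ t) (i : Fin n) :
    yState W t i = ∑ l, transition W t s i l * yState W s l := by
  simp_rw [yState_eq_sum_transition, transition_mul (Nat.zero_le s) h, Matrix.mul_apply, mul_sum]
  exact sum_comm

/-- Before time `m` the diagonal entry alone suffices; afterwards the last `m` steps distribute the
total mass `n` with coefficients at least `b ^ m`. -/
lemma pow_le_yState (hn : 0 < n) (hnn : ∀ t i j, 0 ≤ W t i j)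
    (hcol : ∀ t j, ∑ i, W t i j = 1) {b : ℝ} (hb : 0 ≤ b) (hb1 : b ≤ 1)
    (hdiag : ∀ t i, b ≤ W t i i) {m : ℕ}
    (hpos : ∀ s i j, b ^ m ≤ transition W (s + m) s i j) (t : ℕ) (i : Fin n) :
    b ^ m ≤ yState W t i := by
  rcases le_total t m with h | h
  · rw [yState_eq_sum_transition]
    calc b ^ m ≤ b ^ (t - 0) := pow_le_pow_of_le_one hb hb1 (by omega)
      _ ≤ transition W t 0 i i := pow_le_transition_diag hnn hb hdiag (Nat.zero_le t) i
      _ ≤ _ := single_le_sum (f := fun k => transition W t 0 i k)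
        (fun k _ => transition_nonneg hnn (Nat.zero_le t) i k) (mem_univ i)
  · obtain ⟨s, rfl⟩ := Nat.exists_eq_add_of_le' h
    rw [yState_eq_sum_mul (Nat.le_add_right s m)]
    calc b ^ m ≤ b ^ m * n := le_mul_of_one_le_right (by positivity) (by exact_mod_cast hn)
      _ = ∑ l, b ^ m * yState W s l := by rw [← mul_sum, sum_yState hcol]
      _ ≤ _ := sum_le_sum fun l _ =>
        mul_le_mul_of_nonneg_right (hpos s i l) (yState_nonneg hnn s l)

/-- The normalized push-sum variable lies within the spread of a row of the transition matrix. -/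
lemma abs_transition_sub_le (hn : 0 < n) (hnn : ∀ t i j, 0 ≤ W t i j)
    (hcol : ∀ t j, ∑ i, W t i j = 1) {s t : ℕ} (h : s ≤ t) {i : Fin n} {S : ℝ}
    (hS : ∀ j k, transition W t s i j - transition W t s i k ≤ S) (j : Fin n) :
    |transition W t s i j - yState W t i / n| ≤ S := by
  have hn' : (0 : ℝ) < n := by exact_mod_cast hn
  -- `yState W t i / n` is the mean of the entries of row `i` with weights `yState W s l / n`, which
  -- sum to one.
  have heq : transition W t s i j - yState W t i / n
      = (∑ l, (transition W t s i j - transition W t s i l) * yState W s l) / n := by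
    simp_rw [sub_mul, sum_sub_distrib, ← mul_sum, sum_yState hcol, ← yState_eq_sum_mul h]
    field_simp
  rw [heq, abs_div, abs_of_pos hn', div_le_iff₀ hn', ← sum_yState hcol s, mul_sum]
  refine (abs_sum_le_sum_abs _ _).trans (sum_le_sum fun l _ => ?_)
  rw [abs_mul, abs_of_nonneg (yState_nonneg hnn s l)]
  exact mul_le_mul_of_nonneg_right (abs_le.2 ⟨by linarith [hS l j], hS j l⟩)
    (yState_nonneg hnn s l)

end Transition

/-- The rate `(1 - b ^ (n * L)) ^ (1 / L)` dominates the contraction over blocks of `n * L` steps,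
up to the factor two. -/
lemma one_sub_pow_div_le {n L : ℕ} (hn : 2 ≤ n) (hL : 0 < L) {b μ : ℝ} (hb : 0 ≤ b)
    (hbn : b ≤ 1 / n) (hμ : μ = (1 - b ^ (n * L)) ^ (1 / (L : ℝ))) (t : ℕ) :
    (1 - n * b ^ (n * L)) ^ (t / (n * L)) ≤ 2 * μ ^ t := by
  have hn' : (2 : ℝ) ≤ n := by exact_mod_cast hn
  have hb1 : b ≤ 1 := hbn.trans (by rw [div_le_one (by linarith)]; linarith)
  set η := b ^ (n * L) with hη
  have hη0 : 0 ≤ η := by positivity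
  have hη1 : η ≤ 1 := pow_le_one₀ hb hb1
  -- Since `n * L ≥ 2`, two factors `b ≤ 1 / n` are available: one absorbs `n`, the other gives `1 /
  -- 2`.
  have hnη : n * η ≤ 1 / 2 := by
    have h1 : η ≤ b ^ 2 := pow_le_pow_of_le_one hb hb1 (by nlinarith)
    have h2 : b ^ 2 ≤ (1 / (n : ℝ)) ^ 2 := by gcongr
    calc n * η ≤ n * (1 / (n : ℝ)) ^ 2 := by gcongr; exact h1.trans h2
      _ = 1 / n := by field_simp
      _ ≤ 1 / 2 := by gcongr
  have hμ0 : 0 ≤ μ := by rw [hμ]; exact Real.rpow_nonneg (by linarith) _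
  have hμL : μ ^ L = 1 - η := by
    rw [hμ, ← Real.rpow_natCast, ← Real.rpow_mul (by linarith),
      one_div_mul_cancel (by positivity), Real.rpow_one]
  have hμ1 : μ ≤ 1 := by
    rw [hμ]; exact Real.rpow_le_one (by linarith) (by linarith) (by positivity)
  have hbern : 1 - n * η ≤ μ ^ (n * L) := by
    rw [mul_comm n L, pow_mul, hμL]
    have := one_add_mul_le_pow (a := -η) (by linarith) n
    calc 1 - n * η = 1 + n * (-η) := by ring
      _ ≤ (1 + -η) ^ n := this
      _ = _ := by ring
  set m := n * L with hm
  have hm0 : 0 < m := by positivity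
  calc (1 - n * η) ^ (t / m) ≤ (μ ^ m) ^ (t / m) := by
        gcongr
        linarith
    -- `hbern` and `hnη` give `2 * μ ^ m ≥ 1`; this spare factor pays for the incomplete last block.
    _ ≤ (2 * μ ^ m) * (μ ^ m) ^ (t / m) :=
        le_mul_of_one_le_left (by positivity) (by linarith)
    _ = 2 * μ ^ (m * (t / m + 1)) := by rw [← pow_mul]; ring
    _ ≤ 2 * μ ^ t := by
        gcongr 2 * ?_
        exact pow_le_pow_of_le_one hμ0 hμ1 (Nat.lt_mul_div_succ t hm0).le

/-! ### Linear iterations with perturbations. -/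

section Perturbed

variable {n : ℕ} {W : ℕ → Matrix (Fin n) (Fin n) ℝ} {E : Type*} [NormedAddCommGroup E]
  [NormedSpace ℝ E]

lemma sum_smul_sum_smul (A B : Matrix (Fin n) (Fin n) ℝ) (v : Fin n → E) (i : Fin n) :
    ∑ j, A i j • ∑ k, B j k • v k = ∑ k, (A * B) i k • v k := by
  simp_rw [Matrix.mul_apply, sum_smul, smul_sum, smul_smul]
  exact sum_comm

/-- Explicit solution of the linear iteration with perturbations `e` before and `h` after each
mixing step. -/
lemma perturbed_eq_sum_transition {x e h : ℕ → Fin n → E}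
    (hx : ∀ t i, x (t + 1) i = ∑ j, W t i j • (x t j + e t j) + h t i) (t : ℕ) (i : Fin n) :
    x t i = ∑ j, transition W t 0 i j • x 0 j + ∑ s ∈ range t,
      (∑ j, transition W t s i j • e s j + ∑ j, transition W t (s + 1) i j • h s j) := by
  induction t generalizing i with
  | zero => simp [transition_self, Matrix.one_apply]
  | succ t ih =>
    have hlast : ∑ j, transition W (t + 1) (t + 1) i j • h t j = h t i := by
      simp [transition_self, Matrix.one_apply]
    have hprev : ∀ s ∈ range t,
        ∑ j, transition W (t + 1) s i j • e s j + ∑ j, transition W (t + 1) (s + 1) i j • h s j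
        = ∑ k, W t i k • (∑ j, transition W t s k j • e s j
          + ∑ j, transition W t (s + 1) k j • h s j) := by
      intro s hs
      rw [mem_range] at hs
      simp_rw [smul_add, sum_add_distrib, sum_smul_sum_smul,
        transition_succ hs.le, transition_succ (Nat.succ_le_of_lt hs)]
    rw [hx, sum_range_succ, hlast, sum_congr rfl hprev, transition_succ (Nat.zero_le t),
      transition_succ le_rfl, transition_self, mul_one, ← sum_smul_sum_smul, sum_comm]
    simp_rw [smul_add, sum_add_distrib, ← smul_sum]
    rw [sum_congr rfl fun j _ => congrArg (W t i j • ·) (ih j)]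
    simp_rw [smul_add, sum_add_distrib, smul_add, sum_add_distrib]
    abel

lemma sum_perturbed (hcol : ∀ t j, ∑ i, W t i j = 1) {x e h : ℕ → Fin n → E}
    (hx : ∀ t i, x (t + 1) i = ∑ j, W t i j • (x t j + e t j) + h t i) (t : ℕ) :
    ∑ i, x t i = ∑ j, x 0 j + ∑ s ∈ range t, (∑ j, e s j + ∑ j, h s j) := by
  induction t with
  | zero => simp
  | succ t ih =>
    simp_rw [hx, sum_add_distrib]
    rw [sum_comm]
    simp_rw [← sum_smul, hcol, one_smul, sum_range_succ, sum_add_distrib, ih, sum_add_distrib]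
    abel

/-- The total `∑ k, x t k` contains every past input with coefficient one, so subtracting `c` times
it replaces each transition entry by its deviation from `c`. The inputs `h s` enter after mixing,
hence the index `s + 1`. -/
lemma norm_perturbed_sub_le (hcol : ∀ t j, ∑ i, W t i j = 1) {x e h : ℕ → Fin n → E}
    (hx : ∀ t i, x (t + 1) i = ∑ j, W t i j • (x t j + e t j) + h t i) {t : ℕ} {i : Fin n}
    {c : ℝ} {r : ℕ → ℝ} (hr : ∀ s ≤ t, ∀ j, |transition W t s i j - c| ≤ r s) :
    ‖x t i - c • ∑ k, x t k‖ ≤ r 0 * ∑ j, ‖x 0 j‖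
      + ∑ s ∈ range t, ∑ j, (r s * ‖e s j‖ + r (s + 1) * ‖h s j‖) := by
  have key : ∀ s ≤ t, ∀ v : Fin n → E,
      ‖∑ j, (transition W t s i j - c) • v j‖ ≤ ∑ j, r s * ‖v j‖ := fun s hs v =>
    (norm_sum_le _ _).trans <| sum_le_sum fun j _ => by
      rw [norm_smul, Real.norm_eq_abs]
      exact mul_le_mul_of_nonneg_right (hr s hs j) (norm_nonneg _)
  have heq : x t i - c • ∑ k, x t k = ∑ j, (transition W t 0 i j - c) • x 0 j
      + ∑ s ∈ range t, (∑ j, (transition W t s i j - c) • e s j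
        + ∑ j, (transition W t (s + 1) i j - c) • h s j) := by
    rw [perturbed_eq_sum_transition hx, sum_perturbed hcol hx]
    simp_rw [sub_smul, sum_sub_distrib, sum_add_distrib, sum_sub_distrib, smul_add, smul_sum]
    abel
  rw [heq, mul_sum]
  refine (norm_add_le _ _).trans (add_le_add (key 0 (Nat.zero_le t) _) ?_)
  refine (norm_sum_le _ _).trans (sum_le_sum fun s hs => ?_)
  rw [mem_range] at hs
  rw [sum_add_distrib]
  exact (norm_add_le _ _).trans (add_le_add (key s hs.le _) (key (s + 1) hs _))

end Perturbed

/-! ### Disagreement between the ratios `z_i` and the average of the `x_i`. -/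

section Deviation

variable {n d : ℕ} {𝔾 : ℕ → Digraph (Fin n)} {L : ℕ} {W : ℕ → Matrix (Fin n) (Fin n) ℝ} {β : ℝ}

lemma WeightAssumption.nonneg (hW : WeightAssumption 𝔾 W β) (t : ℕ) (i j : Fin n) :
    0 ≤ W t i j := by
  by_cases h : (𝔾 t).Adj j i
  · exact hW.pos.le.trans (hW.le_weight t i j h)
  · rw [hW.eq_zero t i j h]

lemma WeightAssumption.eta_pos (hW : WeightAssumption 𝔾 W β) (hn : 0 < n) :
    0 < (min β (1 / (n : ℝ))) ^ (n * L) :=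
  pow_pos (lt_min hW.pos (by positivity)) _

lemma min_one_div_le_one (hn : 0 < n) : min β (1 / (n : ℝ)) ≤ 1 :=
  (min_le_right _ _).trans <| by
    rw [div_le_one (by exact_mod_cast hn)]; exact_mod_cast hn

lemma eta_le_one (hW : WeightAssumption 𝔾 W β) (hn : 0 < n) :
    (min β (1 / (n : ℝ))) ^ (n * L) ≤ 1 :=
  pow_le_one₀ (lt_min hW.pos (by positivity)).le (min_one_div_le_one hn)

lemma eta_le_transition (hself : ∀ t i, (𝔾 t).Adj i i) (hL : UniformlyStronglyConnected 𝔾 L)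
    (hW : WeightAssumption 𝔾 W β) (s : ℕ) (i j : Fin n) :
    (min β (1 / (n : ℝ))) ^ (n * L) ≤ transition W (s + n * L) s i j :=
  pow_le_transition hL hW.nonneg (le_min hW.pos.le (by positivity))
    (fun t i => (min_le_left _ _).trans (hW.le_weight t i i (hself t i)))
    (fun t i j h => (min_le_left _ _).trans (hW.le_weight t i j h)) s i j

lemma eta_le_yState (hn : 0 < n) (hself : ∀ t i, (𝔾 t).Adj i i)
    (hL : UniformlyStronglyConnected 𝔾 L) (hW : WeightAssumption 𝔾 W β) (t : ℕ) (i : Fin n) :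
    (min β (1 / (n : ℝ))) ^ (n * L) ≤ yState W t i :=
  pow_le_yState hn hW.nonneg hW.sum_eq_one (le_min hW.pos.le (by positivity))
    (min_one_div_le_one hn)
    (fun t i => (min_le_left _ _).trans (hW.le_weight t i i (hself t i)))
    (eta_le_transition hself hL hW) t i

lemma transition_sub_le_two_mul_pow (hn : 0 < n) (hself : ∀ t i, (𝔾 t).Adj i i)
    (hL : UniformlyStronglyConnected 𝔾 L) (hW : WeightAssumption 𝔾 W β) {μ : ℝ}
    (hμ0 : 0 ≤ μ) (hμ : μ = (1 - (min β (1 / (n : ℝ))) ^ (n * L)) ^ (1 / (L : ℝ))) {s t : ℕ}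
    (h : s ≤ t) (i j k : Fin n) :
    transition W t s i j - transition W t s i k ≤ 2 * μ ^ (t - s) := by
  rcases Nat.lt_or_ge n 2 with hn2 | hn2
  · obtain rfl : n = 1 := by omega
    rw [Subsingleton.elim j k, sub_self]
    positivity
  · refine (transition_sub_le_pow hn hW.nonneg hW.sum_eq_one (eta_le_transition hself hL hW)
      ((t - s) / (n * L)) ?_ i j k).trans
      (one_sub_pow_div_le hn2 hL.1 (le_min hW.pos.le (by positivity)) (min_le_right _ _) hμ _)
    have := Nat.div_mul_le_self (t - s) (n * L)
    omega

variable {α : ℕ → ℝ} {σ : ℕ → Fin n → ℝ} {g : ℕ → Fin n → EuclideanSpace ℝ (Fin d)}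
  {x₀ : Fin n → EuclideanSpace ℝ (Fin d)}

lemma xState_succ (t : ℕ) (i : Fin n) :
    xState W α σ g x₀ (t + 1) i
      = ∑ j, W t i j • (xState W α σ g x₀ t j + -((α t * σ t j) • g t j))
        + -((α t * (1 - σ t i)) • g t i) := by
  simp only [xState, sub_eq_add_neg]

/-- The inputs before and after mixing add up to `-α(t) g_i(t)` whatever `σ_i(t)` is, so the average
does not see the switching. -/
lemma average_xState_succ (hcol : ∀ t j, ∑ i, W t i j = 1) (t : ℕ) :
    average (xState W α σ g x₀ (t + 1))
      = average (xState W α σ g x₀ t) - α t • average (g t) := by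
  have h : ∑ i, xState W α σ g x₀ (t + 1) i = ∑ i, xState W α σ g x₀ t i - α t • ∑ i, g t i := by
    rw [sum_perturbed hcol (xState_succ (α := α) (σ := σ) (g := g) (x₀ := x₀)),
      sum_perturbed hcol (xState_succ (α := α) (σ := σ) (g := g) (x₀ := x₀)) t,
      sum_range_succ, ← add_assoc, sub_eq_add_neg, ← sum_add_distrib, smul_sum, ← sum_neg_distrib]
    congr 1
    refine sum_congr rfl fun i _ => ?_
    module
  rw [average, average, average, h, smul_sub, smul_comm]

lemma zState_zero : zState W α σ g x₀ 0 = x₀ := by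
  ext1 i; simp [zState, yState, xState]

lemma xState_zero : xState W α σ g x₀ 0 = x₀ := rfl

/-- Distance of the ratios `z_i` to the average of the `x_i`, in terms of any bound on the row
spread of the transition matrices. -/
lemma norm_zState_sub_average_le (hn : 0 < n) (hself : ∀ t i, (𝔾 t).Adj i i)
    (hL : UniformlyStronglyConnected 𝔾 L) (hW : WeightAssumption 𝔾 W β)
    {G : ℝ} (hg : ∀ t i, ‖g t i‖ ≤ G) (hσ : ∀ t i, σ t i = 0 ∨ σ t i = 1) {η μ : ℝ}
    (hη : η = (min β (1 / (n : ℝ))) ^ (n * L))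
    (hμ0 : 0 ≤ μ) (hμ1 : μ ≤ 1)
    (hμ : μ = (1 - (min β (1 / (n : ℝ))) ^ (n * L)) ^ (1 / (L : ℝ))) {t : ℕ}
    (hα : ∀ s ≤ t, 0 ≤ α s) (i : Fin n) :
    ‖zState W α σ g x₀ (t + 1) i - average (xState W α σ g x₀ (t + 1))‖
      ≤ 2 / η * (μ ^ t * ∑ j, ‖x₀ j‖ + n * G * ∑ s ∈ range (t + 1), α s * μ ^ (t - s)) := by
  have hη0 : 0 < η := hη ▸ hW.eta_pos hn
  have hy : η ≤ yState W (t + 1) i := hη ▸ eta_le_yState hn hself hL hW _ _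
  have hy0 : 0 < yState W (t + 1) i := hη0.trans_le hy
  have hG : 0 ≤ G := (norm_nonneg _).trans (hg 0 i)
  have hdev := norm_perturbed_sub_le hW.sum_eq_one
    (xState_succ (W := W) (α := α) (σ := σ) (g := g) (x₀ := x₀)) (t := t + 1) (i := i)
    (c := yState W (t + 1) i / n) (r := fun s => 2 * μ ^ (t + 1 - s))
    (fun s hs => abs_transition_sub_le hn hW.nonneg hW.sum_eq_one hs
      (transition_sub_le_two_mul_pow hn hself hL hW hμ0 hμ hs i))
  have hz : zState W α σ g x₀ (t + 1) i - average (xState W α σ g x₀ (t + 1))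
      = (yState W (t + 1) i)⁻¹ • (xState W α σ g x₀ (t + 1) i
        - (yState W (t + 1) i / n) • ∑ k, xState W α σ g x₀ (t + 1) k) := by
    rw [zState, average, smul_sub, smul_smul]
    congr 2
    field_simp
  rw [hz, norm_smul, norm_inv, Real.norm_eq_abs, abs_of_pos hy0]
  have hpert : ∀ s ∈ range (t + 1), ∀ j,
      2 * μ ^ (t + 1 - s) * ‖-((α s * σ s j) • g s j)‖
        + 2 * μ ^ (t + 1 - (s + 1)) * ‖-((α s * (1 - σ s j)) • g s j)‖
      ≤ 2 * (α s * μ ^ (t - s)) * G := by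
    intro s hs j
    rw [mem_range] at hs
    have hαs := hα s (by omega)
    have hag : 0 ≤ α s * ‖g s j‖ := by positivity
    have hfin : 2 * μ ^ (t - s) * (α s * ‖g s j‖) ≤ 2 * (α s * μ ^ (t - s)) * G := by
      have := mul_le_mul_of_nonneg_left (hg s j)
        (show 0 ≤ 2 * (α s * μ ^ (t - s)) by positivity)
      linarith
    rw [norm_neg, norm_neg, norm_smul, norm_smul, Real.norm_eq_abs, Real.norm_eq_abs,
      Nat.add_sub_add_right]
    -- Exactly one of the two inputs survives. A step taken before mixing gains an extra factor `μ ≤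
    -- 1`, which is discarded to get a common bound.
    rcases hσ s j with h | h
    · simpa [h, abs_of_nonneg hαs] using hfin
    · have : μ ^ (t + 1 - s) ≤ μ ^ (t - s) := pow_le_pow_of_le_one hμ0 hμ1 (by omega)
      have := mul_le_mul_of_nonneg_right this hag
      simp only [h, mul_one, abs_of_nonneg hαs, sub_self, mul_zero, abs_zero, zero_mul, add_zero]
      linarith
  calc _ ≤ η⁻¹ * (2 * μ ^ t * ∑ j, ‖x₀ j‖
        + ∑ s ∈ range (t + 1), ∑ _j : Fin n, 2 * (α s * μ ^ (t - s)) * G) := by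
        refine mul_le_mul (inv_anti₀ hη0 hy) (hdev.trans ?_) (norm_nonneg _) (by positivity)
        refine add_le_add ?_ (sum_le_sum fun s hs => sum_le_sum fun j _ => hpert s hs j)
        have : μ ^ (t + 1 - 0) ≤ μ ^ t := pow_le_pow_of_le_one hμ0 hμ1 (by omega)
        rw [xState_zero]
        gcongr
    _ = _ := by
        have h : ∑ s ∈ range (t + 1), ∑ _j : Fin n, 2 * (α s * μ ^ (t - s)) * G
            = 2 * (n * G * ∑ s ∈ range (t + 1), α s * μ ^ (t - s)) := by
          simp only [sum_const, card_univ, Fintype.card_fin, nsmul_eq_mul, mul_sum]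
          exact sum_congr rfl fun _ _ => by ring
        rw [h]
        ring

/-- With a single agent the ratio is the average. -/
lemma zState_eq_average {W : ℕ → Matrix (Fin 1) (Fin 1) ℝ} (hcol : ∀ t j, ∑ i, W t i j = 1)
    {σ : ℕ → Fin 1 → ℝ} {g : ℕ → Fin 1 → EuclideanSpace ℝ (Fin d)}
    {x₀ : Fin 1 → EuclideanSpace ℝ (Fin d)} (t : ℕ) (i : Fin 1) :
    zState W α σ g x₀ t i = average (xState W α σ g x₀ t) := by
  have hy : yState W t i = 1 := by
    have := sum_yState hcol t
    rw [Subsingleton.elim i 0]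
    simpa using this
  rw [zState, hy, Subsingleton.elim i 0]
  simp [average]

end Deviation

/-! ### Subgradients and the perturbed descent inequality. -/

section Convex

variable {n d : ℕ}

/-- A finite convex function on `ℝᵈ` has a subgradient at every point. -/
lemma exists_isSubgradientAt {h : EuclideanSpace ℝ (Fin d) → ℝ} (hh : ConvexOn ℝ Set.univ h)
    (x : EuclideanSpace ℝ (Fin d)) : ∃ v, IsSubgradientAt h x v := by
  have hcont : Continuous h := hh.locallyLipschitz.continuous
  have hopen : IsOpen {p : EuclideanSpace ℝ (Fin d) × ℝ | p.1 ∈ Set.univ ∧ h p.1 < p.2} := by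
    simpa using isOpen_lt (hcont.comp continuous_fst) continuous_snd
  -- A hyperplane separates `(x, h x)` from the open strict epigraph. Its vertical coefficient `c`
  -- is negative because the epigraph contains points above `(x, h x)`, and dividing by `-c` turns
  -- it into the graph of a supporting affine function.
  obtain ⟨l, hl⟩ := geometric_hahn_banach_open_point hh.convex_strict_epigraph hopen
    (x := (x, h x)) (by simp)
  have hsplit : ∀ y r, l (y, r) = l (y, 0) + r * l (0, 1) := by
    intro y r
    rw [← smul_eq_mul, ← map_smul, ← map_add]
    simp
  set c := l (0, 1) with hc
  have hlt : ∀ y r, h y < r → l (y, 0) + r * c < l (x, 0) + h x * c := by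
    intro y r hr
    rw [← hsplit, ← hsplit]
    exact hl (y, r) ⟨trivial, hr⟩
  have hc0 : c < 0 := by
    have := hlt x (h x + 1) (by linarith)
    linarith
  have hle : ∀ y, l (y, 0) + h y * c ≤ l (x, 0) + h x * c := by
    intro y
    refine le_of_forall_pos_lt_add fun ε hε => ?_
    have := hlt y (h y + ε / -c) (by have := div_pos hε (neg_pos.2 hc0); linarith)
    have hε' : ε / -c * c = -ε := by
      rw [div_neg, neg_mul, div_mul_cancel₀ _ hc0.ne]
    linarith [add_mul (h y) (ε / -c) c]
  refine ⟨(InnerProductSpace.toDual ℝ _).symm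
    ((-c)⁻¹ • l.comp (ContinuousLinearMap.inl ℝ (EuclideanSpace ℝ (Fin d)) ℝ)), fun y => ?_⟩
  rw [InnerProductSpace.toDual_symm_apply]
  have hsub : l (y - x, 0) = l (y, 0) - l (x, 0) := by rw [← map_sub]; simp
  simp only [smul_apply, ContinuousLinearMap.comp_apply,
    ContinuousLinearMap.inl_apply, smul_eq_mul, hsub]
  have := hle y
  rw [inv_mul_eq_div, ← le_sub_iff_add_le', div_le_iff₀ (neg_pos.2 hc0)]
  linarith

lemma sub_norm_mul_le {h : EuclideanSpace ℝ (Fin d) → ℝ} {x v : EuclideanSpace ℝ (Fin d)}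
    (hv : IsSubgradientAt h x v) {G : ℝ} (hG : ‖v‖ ≤ G) (y : EuclideanSpace ℝ (Fin d)) :
    h x - G * ‖y - x‖ ≤ h y := by
  have h1 := hv y
  have h2 := (abs_le.1 (abs_real_inner_le_norm v (y - x))).1
  have h3 := mul_le_mul_of_nonneg_right hG (norm_nonneg (y - x))
  linarith

lemma averageCost_convexOn {f : Fin n → EuclideanSpace ℝ (Fin d) → ℝ}
    (hf : ∀ i, ConvexOn ℝ Set.univ (f i)) : ConvexOn ℝ Set.univ (averageCost f) := by
  refine ⟨convex_univ, fun x _ y _ a b ha hb hab => ?_⟩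
  simp only [averageCost, smul_eq_mul]
  have h : ∑ i, f i (a • x + b • y) ≤ a * ∑ i, f i x + b * ∑ i, f i y := by
    rw [mul_sum, mul_sum, ← sum_add_distrib]
    exact sum_le_sum fun i _ => (hf i).2 trivial trivial ha hb hab
  have := mul_le_mul_of_nonneg_left h (show (0 : ℝ) ≤ 1 / n by positivity)
  linarith

lemma norm_average_le (hn : 0 < n) {v : Fin n → EuclideanSpace ℝ (Fin d)} {G : ℝ}
    (hv : ∀ i, ‖v i‖ ≤ G) : ‖average v‖ ≤ G := by
  have hn' : (0 : ℝ) < n := by exact_mod_cast hn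
  rw [average, norm_smul, Real.norm_eq_abs, abs_of_pos (by positivity), one_div_mul_eq_div,
    div_le_iff₀ hn']
  calc ‖∑ i, v i‖ ≤ ∑ i, ‖v i‖ := norm_sum_le _ _
    _ ≤ ∑ _i : Fin n, G := sum_le_sum fun i _ => hv i
    _ = G * n := by simp [mul_comm]

lemma average_sub_const (hn : 0 < n) (v : Fin n → EuclideanSpace ℝ (Fin d))
    (c : EuclideanSpace ℝ (Fin d)) : average (fun i => v i - c) = average v - c := by
  have hn' : (n : ℝ) ≠ 0 := by exact_mod_cast hn.ne'
  simp only [average, sum_sub_distrib, sum_const, card_univ, Fintype.card_fin, smul_sub]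
  rw [← Nat.cast_smul_eq_nsmul ℝ, smul_smul, one_div_mul_cancel hn', one_smul]

/-- One step of an averaged subgradient method whose subgradients are taken at nearby points. -/
lemma descent_step (hn : 0 < n) {f : Fin n → EuclideanSpace ℝ (Fin d) → ℝ}
    {z g : Fin n → EuclideanSpace ℝ (Fin d)} {G a : ℝ} (ha : 0 ≤ a)
    (hg : ∀ i, IsSubgradientAt (f i) (z i) (g i)) (hgG : ∀ i, ‖g i‖ ≤ G)
    {p : EuclideanSpace ℝ (Fin d)} (hp : ∀ i, ∃ v, IsSubgradientAt (f i) p v ∧ ‖v‖ ≤ G)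
    (x zs : EuclideanSpace ℝ (Fin d)) :
    2 * (a * (averageCost f p - averageCost f zs))
      ≤ ‖x - zs‖ ^ 2 - ‖x - a • average g - zs‖ ^ 2 + a ^ 2 * G ^ 2
        + 2 * (G / n * (a * ∑ i, (‖z i - x‖ + ‖p - z i‖))) := by
  have hn' : (0 : ℝ) < n := by exact_mod_cast hn
  -- Two displacements are paid for: from `p` to `z i` by a bounded subgradient at `p`, and from `z
  -- i` to `x` by Cauchy–Schwarz with `g i`.
  have hterm : ∀ i, f i p - f i zs - G * (‖z i - x‖ + ‖p - z i‖) ≤ inner ℝ (g i) (x - zs) := by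
    intro i
    obtain ⟨v, hv, hvG⟩ := hp i
    have h1 := sub_norm_mul_le hv hvG (z i)
    have h2 := hg i zs
    have h3 := (abs_le.1 (abs_real_inner_le_norm (g i) (x - z i))).1
    have h4 := mul_le_mul_of_nonneg_right (hgG i) (norm_nonneg (x - z i))
    have h5 : inner ℝ (g i) (x - zs) = inner ℝ (g i) (x - z i) - inner ℝ (g i) (zs - z i) := by
      rw [← inner_sub_right]; congr 1; abel
    rw [h5, norm_sub_rev p]
    rw [norm_sub_rev x] at h3 h4
    linarith
  have hinner : averageCost f p - averageCost f zs - G / n * ∑ i, (‖z i - x‖ + ‖p - z i‖)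
      ≤ inner ℝ (average g) (x - zs) := by
    have := sum_le_sum fun i (_ : i ∈ univ) => hterm i
    rw [sum_sub_distrib, sum_sub_distrib, ← mul_sum] at this
    have := mul_le_mul_of_nonneg_left this (show (0 : ℝ) ≤ 1 / n by positivity)
    rw [average, real_inner_smul_left, sum_inner, averageCost, averageCost]
    refine le_of_eq_of_le ?_ this
    ring
  have hexp : ‖x - a • average g - zs‖ ^ 2
      = ‖x - zs‖ ^ 2 - 2 * (a * inner ℝ (average g) (x - zs)) + a ^ 2 * ‖average g‖ ^ 2 := by
    rw [sub_right_comm, norm_sub_sq_real, real_inner_smul_right, norm_smul, mul_pow,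
      Real.norm_eq_abs, sq_abs, real_inner_comm]
  have hsq : a ^ 2 * ‖average g‖ ^ 2 ≤ a ^ 2 * G ^ 2 := by
    gcongr; exact norm_average_le hn hgG
  have := mul_le_mul_of_nonneg_left hinner ha
  rw [hexp]
  linarith

/-- Jensen's inequality for the running weighted average, after summing the descent steps. -/
lemma averageCost_weighted_sub_le (hn : 0 < n) {f : Fin n → EuclideanSpace ℝ (Fin d) → ℝ}
    (hf : ∀ i, ConvexOn ℝ Set.univ (f i)) {z g : ℕ → Fin n → EuclideanSpace ℝ (Fin d)} {G : ℝ}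
    {α : ℕ → ℝ} (hg : ∀ t i, IsSubgradientAt (f i) (z t i) (g t i)) (hgG : ∀ t i, ‖g t i‖ ≤ G)
    {p : ℕ → EuclideanSpace ℝ (Fin d)}
    (hp : ∀ t i, ∃ v, IsSubgradientAt (f i) (p t) v ∧ ‖v‖ ≤ G)
    {x : ℕ → EuclideanSpace ℝ (Fin d)} (hx : ∀ t, x (t + 1) = x t - α t • average (g t))
    (zs : EuclideanSpace ℝ (Fin d)) {N : ℕ} (hα : ∀ t < N, 0 ≤ α t)
    (hpos : 0 < ∑ τ ∈ range N, α τ) :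
    averageCost f ((∑ τ ∈ range N, α τ)⁻¹ • ∑ τ ∈ range N, α τ • p τ) - averageCost f zs
      ≤ (‖x 0 - zs‖ ^ 2 + G ^ 2 * ∑ τ ∈ range N, α τ ^ 2) / (2 * ∑ τ ∈ range N, α τ)
        + G / n * (∑ τ ∈ range N, α τ * ∑ i, (‖z τ i - x τ‖ + ‖p τ - z τ i‖))
          / ∑ τ ∈ range N, α τ := by
  have hJ := (averageCost_convexOn hf).map_centerMass_le (t := range N) (w := α) (p := p)
    (fun i hi => hα i (mem_range.1 hi)) hpos (fun _ _ => trivial)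
  simp only [centerMass, Function.comp, smul_eq_mul] at hJ
  have hsum := sum_le_sum fun τ (hτ : τ ∈ range N) =>
    descent_step hn (hα τ (mem_range.1 hτ)) (hg τ) (hgG τ) (hp τ) (x τ) zs
  simp_rw [← hx, sum_add_distrib, ← mul_sum, ← sum_mul] at hsum
  rw [sum_range_sub' (fun τ => ‖x τ - zs‖ ^ 2)] at hsum
  simp_rw [mul_sub, sum_sub_distrib, ← sum_mul] at hsum
  set A := ∑ τ ∈ range N, α τ
  have hsq : 0 ≤ ‖x N - zs‖ ^ 2 := by positivity
  have hrhs : (‖x 0 - zs‖ ^ 2 + G ^ 2 * ∑ τ ∈ range N, α τ ^ 2) / (2 * A)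
        + G / n * (∑ τ ∈ range N, α τ * ∑ i, (‖z τ i - x τ‖ + ‖p τ - z τ i‖)) / A
      = A⁻¹ * ((‖x 0 - zs‖ ^ 2 + G ^ 2 * ∑ τ ∈ range N, α τ ^ 2) / 2
        + G / n * (∑ τ ∈ range N, α τ * ∑ i, (‖z τ i - x τ‖ + ‖p τ - z τ i‖))) := by
    field_simp
  rw [hrhs]
  refine (sub_le_sub_right hJ _).trans ?_
  rw [← inv_mul_cancel_left₀ hpos.ne' (averageCost f zs), ← mul_sub]
  refine mul_le_mul_of_nonneg_left ?_ (by positivity)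
  simp_rw [sum_add_distrib]
  linarith

end Convex

/-! ### Geometric sums and convolutions. -/

section Geometric

variable {μ : ℝ}

lemma sum_pow_mul_one_sub_le (hμ0 : 0 ≤ μ) (c : ℕ) :
    (∑ s ∈ range c, μ ^ s) * (1 - μ) ≤ 1 := by
  rw [geom_sum_mul_neg]
  linarith [pow_nonneg hμ0 c]

lemma sum_pow_sub_mul_one_sub_le (hμ0 : 0 ≤ μ) (τ : ℕ) :
    (∑ s ∈ range (τ + 1), μ ^ (τ - s)) * (1 - μ) ≤ 1 := by
  have := sum_range_reflect (fun s => μ ^ s) (τ + 1)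
  simp only [Nat.add_sub_cancel] at this
  rw [this]
  exact sum_pow_mul_one_sub_le hμ0 _

/-- A convolution of a nonincreasing sequence with a geometric one, split at the midpoint. -/
lemma sum_antitone_mul_pow_le (hμ0 : 0 ≤ μ) (hμ1 : μ ≤ 1) {α : ℕ → ℝ} (hα : ∀ t, 0 ≤ α t)
    (hanti : Antitone α) (τ : ℕ) :
    (∑ s ∈ range (τ + 1), α s * μ ^ (τ - s)) * (1 - μ)
      ≤ α 0 * μ ^ ((τ : ℝ) / 2) + α ⌈(τ : ℝ) / 2⌉₊ := by
  set c := ⌈(τ : ℝ) / 2⌉₊ with hc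
  have hclt : (c : ℝ) < (τ : ℝ) / 2 + 1 := Nat.ceil_lt_add_one (by positivity)
  have hcτ : c ≤ τ := Nat.ceil_le.2 (by linarith [(Nat.cast_nonneg τ : (0 : ℝ) ≤ τ)])
  have h1μ : 0 ≤ 1 - μ := sub_nonneg.2 hμ1
  have hfirst : (∑ s ∈ range c, α s * μ ^ (τ - s)) * (1 - μ) ≤ α 0 * μ ^ ((τ : ℝ) / 2) := by
    -- In the early half `α s ≤ α 0`, and the smallest exponent `τ + 1 - c` can be factored out; it
    -- is at least `τ / 2` since `c < τ / 2 + 1`.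
    have hle : ∑ s ∈ range c, α s * μ ^ (τ - s)
        ≤ α 0 * μ ^ (τ + 1 - c) * ∑ s ∈ range c, μ ^ s := by
      rw [← sum_range_reflect (fun s => μ ^ s) c, mul_sum]
      refine sum_le_sum fun s hs => ?_
      rw [mem_range] at hs
      rw [mul_assoc, ← pow_add, show τ + 1 - c + (c - 1 - s) = τ - s by omega]
      exact mul_le_mul_of_nonneg_right (hanti (Nat.zero_le s)) (by positivity)
    have hpow : μ ^ (τ + 1 - c) ≤ μ ^ ((τ : ℝ) / 2) := by
      rw [← Real.rpow_natCast]
      refine Real.rpow_le_rpow_of_exponent_ge' hμ0 hμ1 (by positivity) ?_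
      rw [Nat.cast_sub (by omega)]
      push_cast
      linarith
    have h0 := hα 0
    calc _ ≤ α 0 * μ ^ (τ + 1 - c) * (∑ s ∈ range c, μ ^ s) * (1 - μ) := by gcongr
      _ = α 0 * μ ^ (τ + 1 - c) * ((∑ s ∈ range c, μ ^ s) * (1 - μ)) := by ring
      _ ≤ α 0 * μ ^ (τ + 1 - c) * 1 := by
        gcongr; exact sum_pow_mul_one_sub_le hμ0 c
      _ ≤ _ := by rw [mul_one]; gcongr
  have hsecond : (∑ s ∈ Ico c (τ + 1), α s * μ ^ (τ - s)) * (1 - μ) ≤ α c := by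
    have hle : ∑ s ∈ Ico c (τ + 1), α s * μ ^ (τ - s)
        ≤ α c * ∑ s ∈ range (τ + 1), μ ^ (τ - s) := by
      rw [mul_sum]
      have hc0 := hα c
      refine (sum_le_sum fun s hs => mul_le_mul_of_nonneg_right
        (hanti (mem_Ico.1 hs).1) (by positivity)).trans ?_
      refine sum_le_sum_of_subset_of_nonneg (fun s hs => ?_) fun s _ _ => by positivity
      exact mem_range.2 (mem_Ico.1 hs).2
    calc _ ≤ α c * (∑ s ∈ range (τ + 1), μ ^ (τ - s)) * (1 - μ) := by gcongr
      _ = α c * ((∑ s ∈ range (τ + 1), μ ^ (τ - s)) * (1 - μ)) := by ring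
      _ ≤ α c * 1 := by
        gcongr
        · exact hα c
        · exact sum_pow_sub_mul_one_sub_le hμ0 τ
      _ = α c := mul_one _
  rw [← sum_range_add_sum_Ico _ (show c ≤ τ + 1 by omega), add_mul]
  exact add_le_add hfirst hsecond

end Geometric

/-! ### Assembly of the optimality gap. -/

section Main

variable {n d : ℕ} {𝔾 : ℕ → Digraph (Fin n)} {L : ℕ} {W : ℕ → Matrix (Fin n) (Fin n) ℝ} {β : ℝ}
  {α : ℕ → ℝ} {σ : ℕ → Fin n → ℝ} {g : ℕ → Fin n → EuclideanSpace ℝ (Fin d)}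
  {x₀ : Fin n → EuclideanSpace ℝ (Fin d)} {G η μ : ℝ}

lemma rate_nonneg_and_lt_one (hn : 0 < n) (hL : 0 < L) (hW : WeightAssumption 𝔾 W β)
    (hμ : μ = (1 - (min β (1 / (n : ℝ))) ^ (n * L)) ^ (1 / (L : ℝ))) : 0 ≤ μ ∧ μ < 1 := by
  have h0 : 0 < (min β (1 / (n : ℝ))) ^ (n * L) := hW.eta_pos hn
  have h1 : (min β (1 / (n : ℝ))) ^ (n * L) ≤ 1 := eta_le_one hW hn
  rw [hμ]
  exact ⟨Real.rpow_nonneg (by linarith) _,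
    Real.rpow_lt_one (by linarith) (by linarith) (by positivity)⟩

lemma rate_pos (hn : 2 ≤ n) (hL : 0 < L) (hW : WeightAssumption 𝔾 W β)
    (hμ : μ = (1 - (min β (1 / (n : ℝ))) ^ (n * L)) ^ (1 / (L : ℝ))) : 0 < μ := by
  have hn' : (2 : ℝ) ≤ n := by exact_mod_cast hn
  have hb : min β (1 / (n : ℝ)) < 1 :=
    (min_le_right _ _).trans_lt (by rw [div_lt_one (by linarith)]; linarith)
  have h1 : (min β (1 / (n : ℝ))) ^ (n * L) < 1 :=
    pow_lt_one₀ (le_min hW.pos.le (by positivity)) hb (by positivity)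
  rw [hμ]
  exact Real.rpow_pos_of_pos (by linarith) _

/-- The deviation bound in a form that remains true when the rate vanishes. -/
lemma norm_zState_sub_average_le_div (hn : 0 < n) (hself : ∀ t i, (𝔾 t).Adj i i)
    (hL : UniformlyStronglyConnected 𝔾 L) (hW : WeightAssumption 𝔾 W β)
    (hg : ∀ t i, ‖g t i‖ ≤ G) (hσ : ∀ t i, σ t i = 0 ∨ σ t i = 1)
    (hη : η = (min β (1 / (n : ℝ))) ^ (n * L))
    (hμ : μ = (1 - (min β (1 / (n : ℝ))) ^ (n * L)) ^ (1 / (L : ℝ))) {t : ℕ}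
    (hα : ∀ s ≤ t, 0 ≤ α s) (i : Fin n) :
    ‖zState W α σ g x₀ (t + 1) i - average (xState W α σ g x₀ (t + 1))‖
      ≤ 2 / η * (μ ^ t * ∑ j, ‖x₀ j‖
        + n * G / μ * ∑ s ∈ range (t + 1), α s * μ ^ (t - s)) := by
  obtain ⟨hμ0, hμ1⟩ := rate_nonneg_and_lt_one hn hL.1 hW hμ
  have hη0 : 0 < η := hη ▸ hW.eta_pos hn
  have hG : 0 ≤ G := (norm_nonneg _).trans (hg 0 i)
  have hS : 0 ≤ ∑ s ∈ range (t + 1), α s * μ ^ (t - s) := sum_nonneg fun s hs =>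
    mul_nonneg (hα s (Nat.lt_succ_iff.1 (mem_range.1 hs))) (by positivity)
  -- For `n = 1` the rate may be `0`, making `n * G / μ` zero as well, but then the disagreement
  -- itself vanishes. For `n ≥ 2` the rate is positive and dividing by it only weakens the bound.
  rcases Nat.lt_or_ge n 2 with hn2 | hn2
  · obtain rfl : n = 1 := by omega
    rw [zState_eq_average hW.sum_eq_one, sub_self, norm_zero]
    positivity
  · refine (norm_zState_sub_average_le hn hself hL hW hg hσ hη hμ0 hμ1.le hμ hα i).trans ?_
    gcongr
    exact le_div_self (by positivity) (rate_pos hn2 hL.1 hW hμ) hμ1.le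

/-- Optimality gap of the weighted average of points `p t` that stay close to the `z_i(t)`. -/
lemma averageCost_gap_le (hn : 0 < n) (hself : ∀ t i, (𝔾 t).Adj i i)
    (hL : UniformlyStronglyConnected 𝔾 L) (hW : WeightAssumption 𝔾 W β)
    {f : Fin n → EuclideanSpace ℝ (Fin d) → ℝ} (hf : ∀ i, ConvexOn ℝ Set.univ (f i))
    (zs : EuclideanSpace ℝ (Fin d)) (hrun : IsRun f W α σ g x₀)
    (hG : 0 < G) (hg : ∀ t i, ‖g t i‖ ≤ G)
    (hη : η = (min β (1 / (n : ℝ))) ^ (n * L))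
    (hμ : μ = (1 - (min β (1 / (n : ℝ))) ^ (n * L)) ^ (1 / (L : ℝ)))
    {p : ℕ → EuclideanSpace ℝ (Fin d)}
    (hp : ∀ t i, ∃ v, IsSubgradientAt (f i) (p t) v ∧ ‖v‖ ≤ G)
    (hpdist : ∀ t D, (∀ i, ‖zState W α σ g x₀ t i - average (xState W α σ g x₀ t)‖ ≤ D) →
      ‖p t - average (xState W α σ g x₀ t)‖ ≤ D)
    {t : ℕ} (hα : ∀ s ≤ t, 0 < α s) (hanti : ∀ s < t, α (s + 1) ≤ α s) {R : ℕ → ℝ}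
    (hR : ∀ τ < t, (∑ s ∈ range (τ + 1), α s * μ ^ (τ - s)) * (1 - μ) ≤ R τ) :
    averageCost f ((∑ τ ∈ range (t + 1), α τ)⁻¹ • ∑ τ ∈ range (t + 1), α τ • p τ)
        - averageCost f zs
      ≤ (‖average x₀ - zs‖ ^ 2 + G ^ 2 * ∑ τ ∈ range (t + 1), α τ ^ 2)
            / (2 * ∑ τ ∈ range (t + 1), α τ)
        + (G * α 0 * ∑ i, (‖average x₀ - x₀ i‖ + ‖p 0 - x₀ i‖))
            / (n * ∑ τ ∈ range (t + 1), α τ)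
        + (32 * G * ∑ i, ‖x₀ i‖) / η
            * ((∑ τ ∈ range t, α τ * μ ^ τ) / ∑ τ ∈ range (t + 1), α τ)
        + (32 * n * G ^ 2) / (η * μ * (1 - μ))
            * ((∑ τ ∈ range t, α τ * R τ) / ∑ τ ∈ range (t + 1), α τ) := by
  obtain ⟨hμ0, hμ1⟩ := rate_nonneg_and_lt_one hn hL.1 hW hμ
  have hη0 : 0 < η := hη ▸ hW.eta_pos hn
  have hn' : (0 : ℝ) < n := by exact_mod_cast hn
  have h1μ : 0 < 1 - μ := sub_pos.2 hμ1
  have hpos : 0 < ∑ τ ∈ range (t + 1), α τ :=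
    sum_pos (fun τ hτ => hα τ (Nat.lt_succ_iff.1 (mem_range.1 hτ))) ⟨0, by simp⟩
  set x := fun t => average (xState W α σ g x₀ t) with hxdef
  set z := zState W α σ g x₀ with hzdef
  have hmain := averageCost_weighted_sub_le hn hf (z := z) (p := p) (x := x) (N := t + 1)
    hrun.subgradient hg hp (average_xState_succ hW.sum_eq_one) zs
    (fun s hs => (hα s (Nat.lt_succ_iff.1 hs)).le) hpos
  refine hmain.trans ?_
  set A := ∑ τ ∈ range (t + 1), α τ
  set X := ∑ i, ‖x₀ i‖ with hX
  have hX0 : 0 ≤ X := sum_nonneg fun i _ => norm_nonneg _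
  have hdev : ∀ τ < t, ∑ i, (‖z (τ + 1) i - x (τ + 1)‖ + ‖p (τ + 1) - z (τ + 1) i‖)
      ≤ n * (32 / η * (μ ^ τ * X) + 32 * n * G / (η * μ * (1 - μ)) * R τ) := by
    intro τ hτ
    have hRτ : ∑ s ∈ range (τ + 1), α s * μ ^ (τ - s) ≤ R τ / (1 - μ) :=
      (le_div_iff₀ h1μ).2 (hR τ hτ)
    have hS0 : 0 ≤ ∑ s ∈ range (τ + 1), α s * μ ^ (τ - s) := sum_nonneg fun s hs =>
      mul_nonneg (hα s (by have := mem_range.1 hs; omega)).le (by positivity)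
    have hRτ0 : 0 ≤ R τ / (1 - μ) := hS0.trans hRτ
    have hD : ∀ i, ‖z (τ + 1) i - x (τ + 1)‖
        ≤ 2 / η * (μ ^ τ * X + n * G / μ * (R τ / (1 - μ))) := fun i =>
      (norm_zState_sub_average_le_div hn hself hL hW hg hrun.switching hη hμ
        (fun s hs => (hα s (by omega)).le) i).trans (by gcongr)
    set D := 2 / η * (μ ^ τ * X + n * G / μ * (R τ / (1 - μ))) with hDdef
    have hD0 : 0 ≤ D := by positivity
    have hpD : ‖p (τ + 1) - x (τ + 1)‖ ≤ D := hpdist (τ + 1) D hD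
    calc ∑ i, (‖z (τ + 1) i - x (τ + 1)‖ + ‖p (τ + 1) - z (τ + 1) i‖)
        -- The triangle inequality through `x (τ + 1)` gives `3 * D`; the generous `16`, times the
        -- `2` in `D`, produces the stated `32`.
        ≤ ∑ _i : Fin n, 16 * D := sum_le_sum fun i _ => by
          have := norm_sub_le_norm_sub_add_norm_sub (p (τ + 1)) (x (τ + 1)) (z (τ + 1) i)
          rw [norm_sub_rev (x (τ + 1))] at this
          linarith [hD i]
      _ = n * (16 * D) := by simp
      _ = _ := by
          have : D = 2 / η * (μ ^ τ * X) + 2 * n * G / (η * μ * (1 - μ)) * R τ := by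
            rw [hDdef, mul_add]
            congr 1
            simp only [div_eq_mul_inv, mul_inv]
            ring
          rw [this]
          ring
  have hsum : ∑ τ ∈ range (t + 1), α τ * ∑ i, (‖z τ i - x τ‖ + ‖p τ - z τ i‖)
      ≤ α 0 * ∑ i, (‖average x₀ - x₀ i‖ + ‖p 0 - x₀ i‖)
        + n * (32 / η * X * (∑ τ ∈ range t, α τ * μ ^ τ)
          + 32 * n * G / (η * μ * (1 - μ)) * ∑ τ ∈ range t, α τ * R τ) := by
    -- The term at time `0` is kept exactly, as the disagreement bound starts at time `1`. The
    -- others are shifted by one, which `α (τ + 1) ≤ α τ` allows.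
    rw [sum_range_succ', add_comm]
    refine add_le_add (le_of_eq ?_) ?_
    · simp only [hzdef, hxdef, zState_zero, xState_zero, norm_sub_rev (average x₀)]
    · rw [mul_sum (range t) _ (32 / η * X), mul_sum (range t) _ (32 * n * G / (η * μ * (1 - μ))),
        ← sum_add_distrib, mul_sum]
      refine sum_le_sum fun τ hτ => ?_
      have hτ := mem_range.1 hτ
      have h0 : 0 ≤ ∑ i, (‖z (τ + 1) i - x (τ + 1)‖ + ‖p (τ + 1) - z (τ + 1) i‖) :=
        sum_nonneg fun i _ => by positivity
      refine (mul_le_mul (hanti τ hτ) (hdev τ hτ) h0 (hα τ hτ.le).le).trans (le_of_eq ?_)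
      ring
  have hscaled := mul_le_mul_of_nonneg_left hsum (show 0 ≤ G / n / A by positivity)
  have hx0 : x 0 = average x₀ := rfl
  rw [hx0, add_assoc, add_assoc]
  refine add_le_add le_rfl (le_trans (le_of_eq (by ring)) (hscaled.trans (le_of_eq ?_)))
  have hcancel : G / n / A * (n * (32 / η * X * (∑ τ ∈ range t, α τ * μ ^ τ)
      + 32 * n * G / (η * μ * (1 - μ)) * ∑ τ ∈ range t, α τ * R τ))
      = G / A * (32 / η * X * (∑ τ ∈ range t, α τ * μ ^ τ)
      + 32 * n * G / (η * μ * (1 - μ)) * ∑ τ ∈ range t, α τ * R τ) := by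
    field_simp
  rw [mul_add, hcancel]
  simp only [div_eq_mul_inv, mul_inv]
  ring

lemma norm_average_sub_le (hn : 0 < n) {v : Fin n → EuclideanSpace ℝ (Fin d)}
    {c : EuclideanSpace ℝ (Fin d)} {D : ℝ} (h : ∀ i, ‖v i - c‖ ≤ D) : ‖average v - c‖ ≤ D := by
  rw [← average_sub_const hn]
  exact norm_average_le hn h

/-- The case of a constant step size `a` over `t + 1` steps with `a ^ 2 * (t + 1) = 1`. -/
lemma averageCost_gap_const_le (hn : 0 < n) (hself : ∀ t i, (𝔾 t).Adj i i)
    (hL : UniformlyStronglyConnected 𝔾 L) (hW : WeightAssumption 𝔾 W β)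
    {f : Fin n → EuclideanSpace ℝ (Fin d) → ℝ} (hf : ∀ i, ConvexOn ℝ Set.univ (f i))
    (zs : EuclideanSpace ℝ (Fin d)) (hrun : IsRun f W α σ g x₀)
    (hG : 0 < G) (hg : ∀ t i, ‖g t i‖ ≤ G)
    (hη : η = (min β (1 / (n : ℝ))) ^ (n * L))
    (hμ : μ = (1 - (min β (1 / (n : ℝ))) ^ (n * L)) ^ (1 / (L : ℝ)))
    {p : ℕ → EuclideanSpace ℝ (Fin d)}
    (hp : ∀ t i, ∃ v, IsSubgradientAt (f i) (p t) v ∧ ‖v‖ ≤ G)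
    (hpdist : ∀ t D, (∀ i, ‖zState W α σ g x₀ t i - average (xState W α σ g x₀ t)‖ ≤ D) →
      ‖p t - average (xState W α σ g x₀ t)‖ ≤ D)
    {T : ℕ} (hT : 0 < T) (hα : ∀ t < T, α t = 1 / √(T : ℝ)) :
    averageCost f ((T : ℝ)⁻¹ • ∑ τ ∈ range T, p τ) - averageCost f zs
      ≤ (‖average x₀ - zs‖ ^ 2 + G ^ 2) / (2 * √(T : ℝ))
        + (G * ∑ i, (‖average x₀ - x₀ i‖ + ‖p 0 - x₀ i‖)) / (n * T)
        + (32 * G * ∑ i, ‖x₀ i‖) / (η * (1 - μ) * T)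
        + (32 * n * G ^ 2) / (η * μ * (1 - μ) * √(T : ℝ)) := by
  obtain ⟨hμ0, hμ1⟩ := rate_nonneg_and_lt_one hn hL.1 hW hμ
  have hη0 : 0 < η := hη ▸ hW.eta_pos hn
  have hn' : (0 : ℝ) < n := by exact_mod_cast hn
  have h1μ : 0 < 1 - μ := sub_pos.2 hμ1
  obtain ⟨t, rfl⟩ : ∃ t, T = t + 1 := ⟨T - 1, by omega⟩
  set r := √((t + 1 : ℕ) : ℝ) with hr
  have hr0 : 0 < r := Real.sqrt_pos.2 (by positivity)
  have hrr : r * r = ((t + 1 : ℕ) : ℝ) := Real.mul_self_sqrt (by positivity)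
  have ha : ∀ τ ∈ range (t + 1), α τ = 1 / r := fun τ hτ => hα τ (mem_range.1 hτ)
  have hA : ∑ τ ∈ range (t + 1), α τ = r := by
    rw [sum_congr rfl ha, sum_const, card_range, nsmul_eq_mul, ← hrr]
    field_simp
  have hsq : ∑ τ ∈ range (t + 1), α τ ^ 2 = 1 := by
    rw [sum_congr rfl fun τ hτ => by rw [ha τ hτ], sum_const, card_range, nsmul_eq_mul, ← hrr]
    field_simp
  have hp_sum : (∑ τ ∈ range (t + 1), α τ)⁻¹ • ∑ τ ∈ range (t + 1), α τ • p τ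
      = ((t + 1 : ℕ) : ℝ)⁻¹ • ∑ τ ∈ range (t + 1), p τ := by
    rw [hA, sum_congr rfl fun τ hτ => by rw [ha τ hτ], ← smul_sum, smul_smul, ← hrr]
    congr 1
    field_simp
  have hlt : ∀ τ ∈ range t, α τ = 1 / r := fun τ hτ =>
    hα τ ((mem_range.1 hτ).trans (Nat.lt_succ_self t))
  -- The step size is prescribed only before `T`, so positivity and monotonicity are supplied only
  -- up to `t = T - 1`. With constant steps the convolution is `1 / r` times a geometric sum, so `R`
  -- can be constant.
  have hmain := averageCost_gap_le (t := t) (R := fun _ => 1 / r) hn hself hL hW hf zs hrun hG hg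
    hη hμ hp hpdist
    (fun s hs => by rw [hα s (Nat.lt_succ_iff.2 hs)]; positivity)
    (fun s hs => by rw [hα s (by omega), hα (s + 1) (by omega)])
    (fun τ hτ => by
      rw [sum_congr rfl fun s hs => by rw [hα s (by have := mem_range.1 hs; omega)],
        ← mul_sum, mul_assoc]
      exact mul_le_of_le_one_right (by positivity) (sum_pow_sub_mul_one_sub_le hμ0 τ))
  rw [hp_sum, hA, hsq, mul_one, hα 0 (Nat.succ_pos t)] at hmain
  have hgeom : ∑ τ ∈ range t, α τ * μ ^ τ ≤ 1 / r * (1 / (1 - μ)) := by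
    rw [sum_congr rfl fun τ hτ => by rw [hlt τ hτ], ← mul_sum]
    gcongr
    exact (le_div_iff₀ h1μ).2 (sum_pow_mul_one_sub_le hμ0 t)
  have hsteps : ∑ τ ∈ range t, α τ * (1 / r) ≤ 1 := by
    rw [sum_congr rfl fun τ hτ => by rw [hlt τ hτ], sum_const, card_range, nsmul_eq_mul]
    have : (t : ℝ) ≤ r * r := by rw [hrr]; push_cast; linarith
    calc (t : ℝ) * (1 / r * (1 / r)) ≤ r * r * (1 / r * (1 / r)) := by gcongr
      _ = 1 := by field_simp
  have hX0 : 0 ≤ ∑ i, ‖x₀ i‖ := sum_nonneg fun i _ => norm_nonneg _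
  refine hmain.trans (add_le_add (add_le_add (add_le_add le_rfl (le_of_eq ?_)) ?_) ?_)
  · rw [← hrr]
    field_simp
  · calc _ ≤ (32 * G * ∑ i, ‖x₀ i‖) / η * (1 / r * (1 / (1 - μ)) / r) := by gcongr
      _ = _ := by
        rw [← hrr]
        field_simp
  · calc _ ≤ (32 * n * G ^ 2) / (η * μ * (1 - μ)) * (1 / r) := by gcongr
      _ = _ := by rw [div_mul_div_comm, mul_one]

end Main

end HeteroPush

end

theorem theorem2 {n d : ℕ} (hn : 0 < n)
    -- the network and the weights
    (𝔾 : ℕ → Digraph (Fin n)) (hself : ∀ t i, (𝔾 t).Adj i i)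
    (L : ℕ) (hL : HeteroPush.UniformlyStronglyConnected 𝔾 L)
    (W : ℕ → Matrix (Fin n) (Fin n) ℝ) (β : ℝ) (hW : HeteroPush.WeightAssumption 𝔾 W β)
    -- the private convex costs and an optimal point
    (f : Fin n → EuclideanSpace ℝ (Fin d) → ℝ) (hf : ∀ i, ConvexOn ℝ Set.univ (f i))
    (zs : EuclideanSpace ℝ (Fin d))
    (hzs : zs ∈ HeteroPush.optimalSet (HeteroPush.averageCost f))
    -- a run of the algorithm
    (α : ℕ → ℝ) (σ : ℕ → Fin n → ℝ) (g : ℕ → Fin n → EuclideanSpace ℝ (Fin d))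
    (x₀ : Fin n → EuclideanSpace ℝ (Fin d)) (hrun : HeteroPush.IsRun f W α σ g x₀)
    (z : ℕ → Fin n → EuclideanSpace ℝ (Fin d)) (hz : z = HeteroPush.zState W α σ g x₀)
    (zbar : ℕ → EuclideanSpace ℝ (Fin d)) (hzbar : zbar = fun t => HeteroPush.average (z t))
    (G : ℝ) (hG : 0 < G) (hsub : HeteroPush.SubgradientsBoundedBy f z G)
    -- the constants
    (η μ : ℝ) (hη : η = (min β (1 / (n : ℝ))) ^ (n * L))
    (hμ : μ = (1 - (min β (1 / (n : ℝ))) ^ (n * L)) ^ (1 / (L : ℝ))) :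
    -- time-varying step size
    (HeteroPush.StepSizeAssumption α → ∀ t : ℕ,
      HeteroPush.averageCost f
          ((∑ τ ∈ range (t + 1), α τ)⁻¹ • ∑ τ ∈ range (t + 1), α τ • zbar τ)
          - HeteroPush.averageCost f zs
        ≤ (‖zbar 0 - zs‖ ^ 2 + G ^ 2 * ∑ τ ∈ range (t + 1), α τ ^ 2)
              / (2 * ∑ τ ∈ range (t + 1), α τ)
          + (2 * G * α 0 * ∑ i, ‖zbar 0 - z 0 i‖) / (n * ∑ τ ∈ range (t + 1), α τ)
          + (32 * G * ∑ i, ‖x₀ i‖) / η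
              * ((∑ τ ∈ range t, α τ * μ ^ τ) / ∑ τ ∈ range (t + 1), α τ)
          + (32 * n * G ^ 2) / (η * μ * (1 - μ))
              * ((∑ τ ∈ range t, α τ * (α 0 * μ ^ ((τ : ℝ) / 2) + α ⌈(τ : ℝ) / 2⌉₊))
                  / ∑ τ ∈ range (t + 1), α τ)
      ∧ ∀ k : Fin n,
        HeteroPush.averageCost f
            ((∑ τ ∈ range (t + 1), α τ)⁻¹ • ∑ τ ∈ range (t + 1), α τ • z τ k)
            - HeteroPush.averageCost f zs
          ≤ (‖zbar 0 - zs‖ ^ 2 + G ^ 2 * ∑ τ ∈ range (t + 1), α τ ^ 2)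
                / (2 * ∑ τ ∈ range (t + 1), α τ)
            + (G * α 0 * ∑ i, (‖zbar 0 - z 0 i‖ + ‖z 0 k - z 0 i‖))
                / (n * ∑ τ ∈ range (t + 1), α τ)
            + (32 * n * G ^ 2) / (η * μ * (1 - μ))
                * ((∑ τ ∈ range t, α τ * (α 0 * μ ^ ((τ : ℝ) / 2) + α ⌈(τ : ℝ) / 2⌉₊))
                    / ∑ τ ∈ range (t + 1), α τ)
            + (32 * G * ∑ i, ‖x₀ i‖) / η
                * ((∑ τ ∈ range t, α τ * μ ^ τ) / ∑ τ ∈ range (t + 1), α τ))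
    ∧
    -- fixed step size over `T` steps
    (∀ T : ℕ, 0 < T → (∀ t < T, α t = 1 / √(T : ℝ)) →
      HeteroPush.averageCost f ((T : ℝ)⁻¹ • ∑ τ ∈ range T, zbar τ)
          - HeteroPush.averageCost f zs
        ≤ (‖zbar 0 - zs‖ ^ 2 + G ^ 2) / (2 * √(T : ℝ))
          + (2 * G * ∑ i, ‖zbar 0 - z 0 i‖) / (n * T)
          + (32 * G * ∑ i, ‖x₀ i‖) / (η * (1 - μ) * T)
          + (32 * n * G ^ 2) / (η * μ * (1 - μ) * √(T : ℝ))
      ∧ ∀ k : Fin n,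
        HeteroPush.averageCost f ((T : ℝ)⁻¹ • ∑ τ ∈ range T, z τ k)
            - HeteroPush.averageCost f zs
          ≤ (‖zbar 0 - zs‖ ^ 2 + G ^ 2) / (2 * √(T : ℝ))
            + (32 * G * ∑ i, ‖x₀ i‖) / (η * (1 - μ) * T)
            + (G * ∑ i, (‖zbar 0 - z 0 i‖ + ‖z 0 k - z 0 i‖)) / (n * T)
            + (32 * n * G ^ 2) / (η * μ * (1 - μ) * √(T : ℝ))) := by
  subst hz hzbar
  have hg : ∀ t i, ‖g t i‖ ≤ G := fun t i =>
    hsub t i _ (Or.inr ⟨i, rfl⟩) _ (hrun.subgradient t i)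
  have hsubgrad : ∀ t p, (p = HeteroPush.average (HeteroPush.zState W α σ g x₀ t) ∨ ∃ k, p = HeteroPush.zState W α σ g x₀ t k) →
      ∀ i, ∃ v, HeteroPush.IsSubgradientAt (f i) p v ∧ ‖v‖ ≤ G := fun t p h i =>
    let ⟨v, hv⟩ := HeteroPush.exists_isSubgradientAt (hf i) p
    ⟨v, hv, hsub t i p h v hv⟩
  have hpbar := fun t => hsubgrad t _ (Or.inl rfl)
  have hpk := fun (k : Fin n) t => hsubgrad t _ (Or.inr ⟨k, rfl⟩)
  -- The average and each single `z_k` stay in any ball about x̄ that contains all `z_i`, so one gap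
  -- estimate serves both.
  have hdbar : ∀ t D, (∀ i, ‖HeteroPush.zState W α σ g x₀ t i - HeteroPush.average (HeteroPush.xState W α σ g x₀ t)‖ ≤ D) →
      ‖HeteroPush.average (HeteroPush.zState W α σ g x₀ t) - HeteroPush.average (HeteroPush.xState W α σ g x₀ t)‖ ≤ D :=
    fun t D h => HeteroPush.norm_average_sub_le hn h
  have hdk : ∀ k t D, (∀ i, ‖HeteroPush.zState W α σ g x₀ t i - HeteroPush.average (HeteroPush.xState W α σ g x₀ t)‖ ≤ D) →
      ‖HeteroPush.zState W α σ g x₀ t k - HeteroPush.average (HeteroPush.xState W α σ g x₀ t)‖ ≤ D := fun k t D h => h k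
  obtain ⟨hμ0, hμ1⟩ := HeteroPush.rate_nonneg_and_lt_one hn hL.1 hW hμ
  have htwo : ∀ a : ℝ, G * a * ∑ i, (‖HeteroPush.average x₀ - x₀ i‖ + ‖HeteroPush.average x₀ - x₀ i‖)
      = 2 * G * a * ∑ i, ‖HeteroPush.average x₀ - x₀ i‖ := fun a => by
    rw [sum_add_distrib]; ring
  have htwo' : G * ∑ i, (‖HeteroPush.average x₀ - x₀ i‖ + ‖HeteroPush.average x₀ - x₀ i‖)
      = 2 * G * ∑ i, ‖HeteroPush.average x₀ - x₀ i‖ := by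
    rw [sum_add_distrib]; ring
  simp only [HeteroPush.zState_zero]
  refine ⟨fun hstep t => ?_, fun T hT hα => ?_⟩
  · have hR := fun τ (_ : τ < t) => HeteroPush.sum_antitone_mul_pow_le hμ0 hμ1.le
      (fun t => (hstep.pos t).le) hstep.antitone τ
    have hα := fun s (_ : s ≤ t) => hstep.pos s
    have hanti := fun s (_ : s < t) => hstep.antitone (Nat.le_succ s)
    refine ⟨?_, fun k => ?_⟩
    · have := HeteroPush.averageCost_gap_le hn hself hL hW hf zs hrun hG hg hη hμ hpbar hdbar hα hanti hR
      simpa only [HeteroPush.zState_zero, htwo] using this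
    · have := HeteroPush.averageCost_gap_le hn hself hL hW hf zs hrun hG hg hη hμ (hpk k) (hdk k) hα hanti hR
      simp only [HeteroPush.zState_zero] at this
      linarith
  · refine ⟨?_, fun k => ?_⟩
    · have := HeteroPush.averageCost_gap_const_le hn hself hL hW hf zs hrun hG hg hη hμ hpbar hdbar hT hα
      simpa only [HeteroPush.zState_zero, htwo'] using this
    · have := HeteroPush.averageCost_gap_const_le hn hself hL hW hf zs hrun hG hg hη hμ (hpk k) (hdk k) hT hα
      simp only [HeteroPush.zState_zero] at this
      linarith
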